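/- **Definitions.** A *positively ordered monoid* is a commutative monoid $S$ with a partial order such that $0\le x$ for all $x\in S$ and $x\le y$ implies $x+z\le y+z$. For $x,y\in S$ write $x\ll y$ if, for every increasing sequence $(z_m)_m$ in $S$ whose supremum exists and satisfies $y\le\sup_m z_m$, there is $m$ with $x\le z_m$. An element $p$ is *compact* if $p\ll p$. A *$\mathrm{Cu}$-semigroup* is a positively ordered monoid such that: (O1) every increasing sequence has a supremum; (O2) every element is the supremum of a $\ll$-increasing sequence; (O3) $x'\ll x$ and $y'\ll y$ imply $x'+y'\ll x+y$; (O4) $\sup_m x_m+\sup_m y_m=\sup_m(x_m+y_m)$ for all increasing sequences $(x_m)_m$, $(y_m)_m$. A *$\mathrm{Cu}$-morphism* is an additive, zero-preserving and order-preserving map that preserves $\ll$ and suprema of increasing sequences. $S$ is *weakly cancellative* if $x+z\ll y+z$ implies $x\ll y$, and it satisfies *(O5)* if whenever $x+y\le z$, $x'\ll x$ and $y'\ll y$, there is $c\in S$ with $x'+c\le z\le x+c$ and $y'\ll c$. Let $\mathrm{Lsc}([0,1],\overline{\mathbb N})$ be the $\mathrm{Cu}$-semigroup of lower semicontinuous functions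 $[0,1]\to\overline{\mathbb N}=\{0,1,2,\dots,\infty\}$ with pointwise order and addition, and let $\chi_U$ be the indicator function of $U$. **Theorem.** Let $S$ be a weakly cancellative $\mathrm{Cu}$-semigroup satisfying (O5). Let $n\ge 1$, let $s_1\ll s_2\ll\cdots\ll s_n$ be elements of $S$, and let $p\in S$ be a compact element with $s_n\le p$. Then there exists a $\mathrm{Cu}$-morphism $\phi\colon \mathrm{Lsc}([0,1],\overline{\mathbb N})\to S$ such that $\phi(1)=p$ and $$\phi\bigl(\chi_{(\frac{n-k}{n},1]}\bigr)=s_k\qquad\text{for every } k=1,\dots,n.$$ -/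

import Mathlib

/-- A positively ordered monoid: a commutative monoid (written additively) with a
translation-invariant partial order whose least element is `0`. -/
class PositivelyOrderedMonoid (S : Type*) extends
    AddCommMonoid S, PartialOrder S, IsOrderedAddMonoid S where
  /-- Every element is positive. -/
  zero_le_elem : ∀ x : S, 0 ≤ x

/-- The sequential way-below relation `x ≪ y`: whenever `z` is an increasing sequence that has a
supremum `a` with `y ≤ a`, some term of `z` lies above `x`. -/
def WayBelow {S : Type*} [PartialOrder S] (x y : S) : Prop :=
  ∀ (z : ℕ → S) (a : S), Monotone z → IsLUB (Set.range z) a → y ≤ a → ∃ n, x ≤ z n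

/-- An element is compact if it is way-below itself. -/
def IsCuCompact {S : Type*} [PartialOrder S] (p : S) : Prop :=
  WayBelow p p

/-- A `Cu`-semigroup: a positively ordered monoid satisfying (O1)-(O4). -/
class CuSemigroup (S : Type*) [PositivelyOrderedMonoid S] : Prop where
  /-- Increasing sequences have suprema. -/
  axiomO1 : ∀ u : ℕ → S, Monotone u → ∃ a, IsLUB (Set.range u) a
  /-- Every element is the supremum of a `≪`-increasing sequence. -/
  axiomO2 : ∀ x : S, ∃ u : ℕ → S, (∀ n, WayBelow (u n) (u (n + 1))) ∧ IsLUB (Set.range u) x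
  /-- The way-below relation is compatible with addition. -/
  axiomO3 : ∀ x' x y' y : S, WayBelow x' x → WayBelow y' y → WayBelow (x' + y') (x + y)
  /-- Suprema of increasing sequences are compatible with addition. -/
  axiomO4 : ∀ (u v : ℕ → S) (a b : S), Monotone u → Monotone v →
    IsLUB (Set.range u) a → IsLUB (Set.range v) b →
    IsLUB (Set.range fun n => u n + v n) (a + b)

/-- Axiom (O5): if `x + y ≤ z`, `x' ≪ x` and `y' ≪ y`, then there is `c` such that
`x' + c ≤ z ≤ x + c` and `y' ≪ c`. -/
def SatisfiesO5 (S : Type*) [PositivelyOrderedMonoid S] : Prop :=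
  ∀ x' x y' y z : S, x + y ≤ z → WayBelow x' x → WayBelow y' y →
    ∃ c : S, x' + c ≤ z ∧ z ≤ x + c ∧ WayBelow y' c

/-- Weak cancellation: `x + z ≪ y + z` implies `x ≪ y`. -/
def WeaklyCancellative (S : Type*) [PositivelyOrderedMonoid S] : Prop :=
  ∀ x y z : S, WayBelow (x + z) (y + z) → WayBelow x y

/-- A `Cu`-morphism: a morphism of positively ordered monoids (additive, zero- and
order-preserving) that preserves the way-below relation and suprema of increasing sequences. -/
structure CuMorphism (S T : Type*) [PositivelyOrderedMonoid S] [PositivelyOrderedMonoid T]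
    extends S →+ T where
  /-- The map preserves the order. -/
  map_le : ∀ x y : S, x ≤ y → toFun x ≤ toFun y
  /-- The map preserves the way-below relation. -/
  map_wayBelow : ∀ x y : S, WayBelow x y → WayBelow (toFun x) (toFun y)
  /-- The map preserves suprema of increasing sequences. -/
  map_isLUB : ∀ (u : ℕ → S) (a : S), Monotone u → IsLUB (Set.range u) a →
    IsLUB (Set.range fun n => toFun (u n)) (toFun a)

instance {S T : Type*} [PositivelyOrderedMonoid S] [PositivelyOrderedMonoid T] :
    CoeFun (CuMorphism S T) (fun _ => S → T) :=
  ⟨fun φ => φ.toFun⟩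

/-- `Lsc X` is the monoid of lower semicontinuous functions `X → {0, 1, 2, …, ∞}`, with pointwise
addition and pointwise order. -/
def Lsc (X : Type*) [TopologicalSpace X] : Type _ :=
  {f : X → ℕ∞ // LowerSemicontinuous f}

namespace Lsc

instance (X : Type*) [TopologicalSpace X] : PartialOrder (Lsc X) :=
  inferInstanceAs (PartialOrder {f : X → ℕ∞ // LowerSemicontinuous f})

instance (X : Type*) [TopologicalSpace X] : Zero (Lsc X) :=
  ⟨⟨fun _ => 0, lowerSemicontinuous_const⟩⟩

/-- The constant function `1`. -/
instance (X : Type*) [TopologicalSpace X] : One (Lsc X) :=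
  ⟨⟨fun _ => 1, lowerSemicontinuous_const⟩⟩

instance (X : Type*) [TopologicalSpace X] : Add (Lsc X) :=
  ⟨fun f g => ⟨fun x => f.1 x + g.1 x, f.2.add g.2⟩⟩

instance (X : Type*) [TopologicalSpace X] : PositivelyOrderedMonoid (Lsc X) where
  add_assoc f g h := Subtype.ext (funext fun x => add_assoc (f.1 x) (g.1 x) (h.1 x))
  zero_add f := Subtype.ext (funext fun x => zero_add (f.1 x))
  add_zero f := Subtype.ext (funext fun x => add_zero (f.1 x))
  add_comm f g := Subtype.ext (funext fun x => add_comm (f.1 x) (g.1 x))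
  nsmul := nsmulRec
  add_le_add_left f g hfg h := fun x => add_le_add_left (hfg x) (h.1 x)
  zero_le_elem f := fun x => bot_le (a := f.1 x)

/-- The indicator function `χ_U` of an open set `U`. -/
noncomputable def chi {X : Type*} [TopologicalSpace X] (U : TopologicalSpace.Opens X) : Lsc X :=
  ⟨(U : Set X).indicator fun _ => 1, U.isOpen.lowerSemicontinuous_indicator zero_le_one⟩

end Lsc

/-- The interval `(t, 1]`, as an open subset of `[0, 1]`. -/
def openUpper (t : ℝ) : TopologicalSpace.Opens unitInterval :=
  ⟨{x | t < (x : ℝ)}, isOpen_lt continuous_const continuous_subtype_val⟩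

/-! A morphism is determined by what it does to the indicators of (a,1]. Dyadic interpolation in 0 ≪
s 1 ≪ ⋯ ≪ s n ≤ p ≪ p gives a ≪-decreasing path x on the line (`exists_isCuPath`); x a stands for
the image of χ_{(a,1]} up to an arbitrarily small move of a, and each s k is a limit of x from the
right. An increasing step function goes to the sum of x over its jump points, and strict enough
comparison of such functions on [0,1] gives ≪ between the sums (`IsCuPath.sum_wayBelow_sum`).

A general step function is a difference P - Q of increasing ones, while S has no subtraction. (O5)
provides an element that behaves like the difference up to a small move of Q
(`exists_stepDatum_of_multisets`), and weak cancellation compares two such elements as if they were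
true differences (`StepDatum.Prec.wayBelow`).

A lower semicontinuous f is exhausted by step data, each with upper bound below the lower bound of
the next (`exists_represents`); φ f is the supremum of their values. Two exhaustions compare
pointwise on [0,1], and compactness makes the comparison uniform
(`StepDatum.exists_prec_of_directed`). Independence of choices, monotonicity and preservation of
suprema come from this; additivity holds because sums of exhaustions exhaust the sum. -/

section WayBelowBasics

variable {S : Type*}

theorem WayBelow.le [PartialOrder S] {x y : S} (h : WayBelow x y) : x ≤ y := by
  obtain ⟨_, hn⟩ := h (fun _ => y) y monotone_const (by simp) le_rfl
  exact hn

theorem WayBelow.trans_le [PartialOrder S] {x y z : S} (h : WayBelow x y) (hyz : y ≤ z) :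
    WayBelow x z :=
  fun u a hu ha hz => h u a hu ha (hyz.trans hz)

theorem LE.le.trans_wayBelow [PartialOrder S] {x y z : S} (hxy : x ≤ y) (h : WayBelow y z) :
    WayBelow x z := fun u a hu ha hz =>
  let ⟨n, hn⟩ := h u a hu ha hz
  ⟨n, hxy.trans hn⟩

theorem zero_wayBelow [PositivelyOrderedMonoid S] (x : S) : WayBelow 0 x :=
  fun z _ _ _ _ => ⟨0, PositivelyOrderedMonoid.zero_le_elem (z 0)⟩

end WayBelowBasics

/-! ### Dyadic interpolation of ≪-chains -/

section Interpolation

variable {S : Type*} [PositivelyOrderedMonoid S] [CuSemigroup S]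

/-- A chosen `≪`-increasing sequence with supremum `x`. -/
noncomputable def approxSeq (x : S) : ℕ → S :=
  (CuSemigroup.axiomO2 x).choose

theorem approxSeq_wayBelow_succ (x : S) (n : ℕ) :
    WayBelow (approxSeq x n) (approxSeq x (n + 1)) :=
  (CuSemigroup.axiomO2 x).choose_spec.1 n

theorem isLUB_approxSeq (x : S) : IsLUB (Set.range (approxSeq x)) x :=
  (CuSemigroup.axiomO2 x).choose_spec.2

theorem approxSeq_monotone (x : S) : Monotone (approxSeq x) :=
  monotone_nat_of_le_succ fun n => (approxSeq_wayBelow_succ x n).le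

theorem approxSeq_wayBelow (x : S) (n : ℕ) : WayBelow (approxSeq x n) x :=
  (approxSeq_wayBelow_succ x n).trans_le ((isLUB_approxSeq x).1 ⟨n + 1, rfl⟩)

/-- The bound by the m-th approximant forces repeated interpolation to converge to y at the right
end. -/
theorem exists_interpolant {x y : S} (h : WayBelow x y) (m : ℕ) :
    ∃ z, WayBelow x z ∧ WayBelow z y ∧ approxSeq y m ≤ z := by
  obtain ⟨j, hj⟩ := h (approxSeq y) y (approxSeq_monotone y) (isLUB_approxSeq y) le_rfl
  refine ⟨approxSeq y (max j m + 1), ?_, approxSeq_wayBelow _ _,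
    approxSeq_monotone y (by omega)⟩
  exact (hj.trans (approxSeq_monotone y (le_max_left j m))).trans_wayBelow
    (approxSeq_wayBelow_succ y _)

open Classical in
/-- An element between `x` and `y` for `≪`, above the `m`-th approximant of `y`. -/
noncomputable def interpolant (m : ℕ) (x y : S) : S :=
  if h : WayBelow x y then (exists_interpolant h m).choose else x

theorem interpolant_spec {x y : S} (h : WayBelow x y) (m : ℕ) :
    WayBelow x (interpolant m x y) ∧ WayBelow (interpolant m x y) y ∧
      approxSeq y m ≤ interpolant m x y := by
  rw [interpolant, dif_pos h]
  exact (exists_interpolant h m).choose_spec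

/-- Successive dyadic refinements of a `≪`-increasing sequence. -/
noncomputable def dyadicChain (s : ℕ → S) : ℕ → ℕ → S
  | 0, i => s i
  | m + 1, i =>
    if i % 2 = 0 then dyadicChain s m (i / 2)
    else interpolant m (dyadicChain s m (i / 2)) (dyadicChain s m (i / 2 + 1))

theorem dyadicChain_even (s : ℕ → S) (m i : ℕ) :
    dyadicChain s (m + 1) (2 * i) = dyadicChain s m i := by
  simp [dyadicChain]

theorem dyadicChain_odd (s : ℕ → S) (m i : ℕ) :
    dyadicChain s (m + 1) (2 * i + 1) =
      interpolant m (dyadicChain s m i) (dyadicChain s m (i + 1)) := by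
  have h1 : (2 * i + 1) % 2 = 1 := by omega
  have h2 : (2 * i + 1) / 2 = i := by omega
  simp [dyadicChain, h1, h2]

variable {s : ℕ → S}

theorem dyadicChain_wayBelow (hs : ∀ i, WayBelow (s i) (s (i + 1))) (m : ℕ) :
    ∀ i, WayBelow (dyadicChain s m i) (dyadicChain s m (i + 1)) := by
  induction m with
  | zero => exact hs
  | succ m ih =>
    intro i
    obtain ⟨j, rfl | rfl⟩ := i.even_or_odd'
    · rw [dyadicChain_even, dyadicChain_odd]
      exact (interpolant_spec (ih j) m).1
    · rw [show 2 * j + 1 + 1 = 2 * (j + 1) by ring, dyadicChain_even, dyadicChain_odd]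
      exact (interpolant_spec (ih j) m).2.1

theorem dyadicChain_monotone (hs : ∀ i, WayBelow (s i) (s (i + 1))) (m : ℕ) :
    Monotone (dyadicChain s m) :=
  monotone_nat_of_le_succ fun i => (dyadicChain_wayBelow hs m i).le

theorem dyadicChain_pow_mul (s : ℕ → S) (m k : ℕ) : dyadicChain s m (2 ^ m * k) = s k := by
  induction m with
  | zero => simp [dyadicChain]
  | succ m ih => rw [pow_succ', mul_assoc, dyadicChain_even, ih]

/-- The entry just before s (k + 1) at level m + 1 is the interpolant inserted below s (k + 1) at
that step. -/
theorem approxSeq_le_dyadicChain (hs : ∀ i, WayBelow (s i) (s (i + 1))) (m k : ℕ) :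
    approxSeq (s (k + 1)) m ≤ dyadicChain s (m + 1) (2 ^ (m + 1) * (k + 1) - 1) := by
  obtain ⟨j, hj⟩ : ∃ j, 2 ^ m * (k + 1) = j + 1 :=
    Nat.exists_eq_succ_of_ne_zero (by positivity)
  have h1 : 2 ^ (m + 1) * (k + 1) - 1 = 2 * j + 1 := by
    rw [pow_succ', mul_assoc, hj]; omega
  rw [h1, dyadicChain_odd, ← hj, dyadicChain_pow_mul]
  refine (interpolant_spec ?_ m).2.2
  have := dyadicChain_wayBelow hs m j
  rwa [← hj, dyadicChain_pow_mul] at this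

/-- For u > 0 the index is the largest one strictly below 2^m u, so refining only moves the dyadic
point towards u. For u ≤ 0 truncated subtraction gives index 0. -/
theorem dyadicChain_ceil_monotone (hs : ∀ i, WayBelow (s i) (s (i + 1))) (u : ℝ) :
    Monotone fun m => dyadicChain s m (⌈2 ^ m * u⌉₊ - 1) := by
  refine monotone_nat_of_le_succ fun m => ?_
  rw [← dyadicChain_even]
  refine dyadicChain_monotone hs _ ?_
  rcases Nat.eq_zero_or_pos ⌈2 ^ m * u⌉₊ with h | h
  · simp [h]
  · have h1 : ⌈2 ^ m * u⌉₊ - 1 < ⌈2 ^ m * u⌉₊ := by omega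
    rw [Nat.lt_ceil] at h1
    have h2 : 2 * (⌈2 ^ m * u⌉₊ - 1) < ⌈2 ^ (m + 1) * u⌉₊ := by
      rw [Nat.lt_ceil, pow_succ']
      push_cast at h1 ⊢
      linarith
    omega

theorem exists_dense_chain (hs : ∀ i, WayBelow (s i) (s (i + 1))) :
    ∃ y : ℝ → S, (∀ u v, u < v → 0 < v → WayBelow (y u) (y v)) ∧
      (∀ u, u ≤ 0 → y u = s 0) ∧
      (∀ (u : ℝ) (k : ℕ), u ≤ k → y u ≤ s k) ∧
      ∀ (k : ℕ) (u : ℕ → ℝ), (∀ m, u m < (k + 1 : ℕ)) →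
        Filter.Tendsto u Filter.atTop (nhds ((k + 1 : ℕ) : ℝ)) →
        IsLUB (Set.range fun m => y (u m)) (s (k + 1)) := by
  choose y hy using fun u : ℝ => CuSemigroup.axiomO1 _ (dyadicChain_ceil_monotone hs u)
  have hle : ∀ (u : ℝ) (m i : ℕ), 2 ^ m * u ≤ i → y u ≤ dyadicChain s m i := by
    intro u m i hi
    refine (hy u).2 ?_
    rintro _ ⟨l, rfl⟩
    obtain ⟨q, rfl | rfl⟩ : ∃ q, m = l + q ∨ l = m + q := by
      rcases le_total l m with h | h
      · exact ⟨m - l, by omega⟩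
      · exact ⟨l - m, by omega⟩
    · refine (dyadicChain_ceil_monotone hs u (Nat.le_add_right l q)).trans ?_
      refine dyadicChain_monotone hs _ ?_
      have := Nat.ceil_le.2 hi
      omega
    · have h2 : ∀ q, dyadicChain s (m + q) (2 ^ q * i) = dyadicChain s m i := by
        intro q
        induction q with
        | zero => simp
        | succ q ih => rw [← add_assoc, pow_succ', mul_assoc, dyadicChain_even, ih]
      rw [← h2 q]
      refine dyadicChain_monotone hs _ ?_
      have : ⌈(2 : ℝ) ^ (m + q) * u⌉₊ ≤ 2 ^ q * i := by
        rw [Nat.ceil_le, pow_add]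
        push_cast
        have : (0 : ℝ) < 2 ^ q := by positivity
        nlinarith
      omega
  have hge : ∀ (u : ℝ) (m i : ℕ), (i : ℝ) < 2 ^ m * u → dyadicChain s m i ≤ y u := by
    intro u m i hi
    refine le_trans (dyadicChain_monotone hs _ ?_) ((hy u).1 ⟨m, rfl⟩)
    have := Nat.lt_ceil.2 hi
    omega
  refine ⟨y, ?_, ?_, ?_, ?_⟩
  · intro u v huv hv
    wlog hu : 0 ≤ u generalizing u
    · refine LE.le.trans_wayBelow ?_ (this 0 hv le_rfl)
      push Not at hu
      have h0 : y u ≤ dyadicChain s 0 0 := hle u 0 0 (by simpa using hu.le)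
      refine h0.trans ((hy 0).1 ⟨0, ?_⟩)
      simp
    -- With 2^m (v - u) > 2, two consecutive indices fit between 2^m u and 2^m v.
    · obtain ⟨m, hm⟩ := pow_unbounded_of_one_lt (2 / (v - u)) (one_lt_two (α := ℝ))
      rw [div_lt_iff₀ (by linarith)] at hm
      have hc := Nat.ceil_lt_add_one (a := 2 ^ m * u) (by positivity)
      refine ((hle u m _ (Nat.le_ceil _)).trans_wayBelow
        (dyadicChain_wayBelow hs m _)).trans_le (hge v m _ ?_)
      push_cast
      linarith
  · intro u hu
    refine (hy u).unique ?_
    have : ∀ m : ℕ, ⌈2 ^ m * u⌉₊ = 0 := fun m =>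
      Nat.ceil_eq_zero.2 (mul_nonpos_of_nonneg_of_nonpos (by positivity) hu)
    have h2 : ∀ m, dyadicChain s m 0 = s 0 := fun m => by
      simpa using dyadicChain_pow_mul s m 0
    simp [this, h2]
  · intro u k hu
    simpa [dyadicChain] using hle u 0 k (by simpa using hu)
  · intro k u hu hlim
    refine ⟨?_, fun b hb => (isLUB_approxSeq (s (k + 1))).2 ?_⟩
    · rintro _ ⟨m, rfl⟩
      simpa [dyadicChain] using hle (u m) 0 (k + 1) (by simpa using (hu m).le)
    · rintro _ ⟨m, rfl⟩
      have hlt : ((k + 1 : ℕ) : ℝ) - 1 / 2 ^ (m + 1) < (k + 1 : ℕ) := by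
        have : (0 : ℝ) < 1 / 2 ^ (m + 1) := by positivity
        linarith
      obtain ⟨j, hj⟩ := (hlim.eventually (lt_mem_nhds hlt)).exists
      refine (approxSeq_le_dyadicChain hs m k).trans
        ((hge (u j) _ _ ?_).trans (hb ⟨j, rfl⟩))
      have hpos : (0 : ℝ) < 2 ^ (m + 1) := by positivity
      have h1 : 1 ≤ 2 ^ (m + 1) * (k + 1) := Nat.one_le_iff_ne_zero.2 (by positivity)
      rw [Nat.cast_sub h1]
      have h2 := mul_lt_mul_of_pos_left hj hpos
      rw [mul_sub, mul_one_div_cancel hpos.ne'] at h2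
      push_cast at h2 ⊢
      linarith

end Interpolation

/-! ### The path through the prescribed elements -/

section Path

variable {S : Type*} [PositivelyOrderedMonoid S]

/-- A `≪`-decreasing path indexed by the real line, equal to `p` on the negative numbers and to
`0` from `1` on. -/
structure IsCuPath (p : S) (x : ℝ → S) : Prop where
  wayBelow : ∀ a b, a < b → WayBelow (x b) (x a)
  eq_of_neg : ∀ a, a < 0 → x a = p
  eq_zero : ∀ a, 1 ≤ a → x a = 0

theorem exists_isCuPath [CuSemigroup S] {n : ℕ} (hn : 1 ≤ n) {s : ℕ → S}
    (hs : ∀ k : ℕ, 1 ≤ k → k < n → WayBelow (s k) (s (k + 1)))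
    {p : S} (hp : IsCuCompact p) (hsp : s n ≤ p) :
    ∃ x : ℝ → S, IsCuPath p x ∧ ∀ k : ℕ, 1 ≤ k → k ≤ n →
      IsLUB (Set.range fun m : ℕ => x (((n : ℝ) - k) / n + 1 / ((m : ℝ) + 1))) (s k) := by
  -- Padding by 0 in front and by p behind; the constant tail is a ≪-chain because p is compact.
  set σ : ℕ → S := fun k => if k = 0 then 0 else if k ≤ n then s k else p with hσ
  have hσs : ∀ k, 1 ≤ k → k ≤ n → σ k = s k := fun k h1 h2 => by
    simp [hσ, h2, Nat.one_le_iff_ne_zero.1 h1]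
  have hchain : ∀ i, WayBelow (σ i) (σ (i + 1)) := by
    intro i
    rcases Nat.eq_zero_or_pos i with rfl | hi
    · simpa [hσ] using zero_wayBelow _
    rcases lt_trichotomy i n with h | h | h
    · rw [hσs i hi h.le, hσs (i + 1) (by omega) h]
      exact hs i hi h
    · subst h
      rw [hσs i hi le_rfl]
      simpa [hσ] using hsp.trans_wayBelow hp
    · have h1 : ¬ i ≤ n := by omega
      have h2 : ¬ i + 1 ≤ n := by omega
      simpa [hσ, hi.ne', h1, h2] using (show WayBelow p p from hp)
  obtain ⟨y, hy1, hy2, hy3, hy4⟩ := exists_dense_chain hchain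
  have hn0 : (0 : ℝ) < n := by exact_mod_cast hn
  -- The reversal t ↦ n(1 - t) sends (n - k)/n to k. The possible jump to p at 0 is allowed, since
  -- everything below p is ≪ p.
  refine ⟨fun t => if t < 0 then p else y (n * (1 - t)), ⟨?_, ?_, ?_⟩, ?_⟩
  · intro a b hab
    have hyp : ∀ t : ℝ, 0 ≤ t → y (n * (1 - t)) ≤ p := fun t ht =>
      (hy3 _ n (by nlinarith)).trans ((hσs n hn le_rfl).le.trans hsp)
    by_cases ha : a < 0
    · simp only [ha, if_true]
      by_cases hb : b < 0
      · simpa [hb] using (show WayBelow p p from hp)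
      · simpa [hb] using (hyp b (not_lt.1 hb)).trans_wayBelow hp
    · have hb : ¬ b < 0 := by linarith
      simp only [ha, hb, if_false]
      by_cases h1 : b < 1
      · exact hy1 _ _ (by nlinarith) (by nlinarith)
      · rw [hy2 (n * (1 - b)) (by nlinarith)]
        simpa [hσ] using zero_wayBelow _
  · intro a ha
    simp [ha]
  · intro a ha
    have h1 : ¬ a < 0 := by linarith
    simp only [h1, if_false]
    rw [hy2 _ (by nlinarith)]
    simp [hσ]
  · intro k hk1 hkn
    obtain ⟨j, rfl⟩ := Nat.exists_eq_succ_of_ne_zero (Nat.one_le_iff_ne_zero.1 hk1)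
    have hk : ((j + 1 : ℕ) : ℝ) ≤ n := by exact_mod_cast hkn
    have hnn : ∀ m : ℕ, ¬ ((n : ℝ) - (j + 1 : ℕ)) / n + 1 / ((m : ℝ) + 1) < 0 := by
      intro m
      have h1 : 0 ≤ ((n : ℝ) - (j + 1 : ℕ)) / n := div_nonneg (by linarith) hn0.le
      have h2 : 0 ≤ 1 / ((m : ℝ) + 1) := by positivity
      linarith
    have heq : ∀ m : ℕ, (n : ℝ) * (1 - (((n : ℝ) - (j + 1 : ℕ)) / n + 1 / ((m : ℝ) + 1))) =
        (j + 1 : ℕ) - n * (1 / ((m : ℝ) + 1)) := by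
      intro m
      field_simp
      ring
    simp only [hnn, if_false, Nat.succ_eq_add_one, heq]
    rw [← hσs (j + 1) hk1 hkn]
    refine hy4 j _ (fun m => ?_) ?_
    · have : 0 < (n : ℝ) * (1 / ((m : ℝ) + 1)) := by positivity
      linarith
    · simpa using (tendsto_const_nhds (x := ((j + 1 : ℕ) : ℝ))).sub
        ((tendsto_one_div_add_atTop_nhds_zero_nat (𝕜 := ℝ)).const_mul (n : ℝ))

end Path

/-! ### Counting functions of finite multisets and their semicontinuity -/

section Counting

/-- The number of elements `≤ t`. -/
noncomputable def countLE (A : Multiset ℝ) (t : ℝ) : ℕ := A.countP (· ≤ t)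

/-- The number of elements `< t`. -/
noncomputable def countLT (A : Multiset ℝ) (t : ℝ) : ℕ := A.countP (· < t)

@[simp] theorem countLE_add (A B : Multiset ℝ) (t : ℝ) :
    countLE (A + B) t = countLE A t + countLE B t := Multiset.countP_add ..

@[simp] theorem countLT_add (A B : Multiset ℝ) (t : ℝ) :
    countLT (A + B) t = countLT A t + countLT B t := Multiset.countP_add ..

@[simp] theorem countLE_zero (t : ℝ) : countLE 0 t = 0 := Multiset.countP_zero _

@[simp] theorem countLT_zero (t : ℝ) : countLT 0 t = 0 := Multiset.countP_zero _

theorem countLE_cons (a : ℝ) (A : Multiset ℝ) (t : ℝ) :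
    countLE (a ::ₘ A) t = countLE A t + if a ≤ t then 1 else 0 := Multiset.countP_cons ..

theorem countLT_cons (a : ℝ) (A : Multiset ℝ) (t : ℝ) :
    countLT (a ::ₘ A) t = countLT A t + if a < t then 1 else 0 := Multiset.countP_cons ..

@[simp] theorem countLE_singleton (a t : ℝ) :
    countLE {a} t = if a ≤ t then 1 else 0 := by
  rw [← Multiset.cons_zero, countLE_cons]; simp

@[simp] theorem countLT_singleton (a t : ℝ) :
    countLT {a} t = if a < t then 1 else 0 := by
  rw [← Multiset.cons_zero, countLT_cons]; simp

theorem eventually_countLE_le (A : Multiset ℝ) (t : ℝ) :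
    ∀ᶠ r in nhds t, countLE A r ≤ countLE A t := by
  induction A using Multiset.induction_on with
  | empty => simp
  | cons a A ih =>
    have : ∀ᶠ r in nhds t, a ≤ r → a ≤ t := by
      by_cases h : a ≤ t
      · simp [h]
      · filter_upwards [gt_mem_nhds (not_le.1 h)] with r hr h'
        exact absurd h' (not_le.2 hr)
    filter_upwards [ih, this] with r hr hr'
    simp only [countLE_cons]
    split_ifs <;> first | omega | tauto

theorem eventually_le_countLT (A : Multiset ℝ) (t : ℝ) :
    ∀ᶠ r in nhds t, countLT A t ≤ countLT A r := by
  induction A using Multiset.induction_on with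
  | empty => simp
  | cons a A ih =>
    have : ∀ᶠ r in nhds t, a < t → a < r := by
      by_cases h : a < t
      · filter_upwards [lt_mem_nhds h] with r hr _ using hr
      · simp [h]
    filter_upwards [ih, this] with r hr hr'
    simp only [countLT_cons]
    split_ifs <;> first | omega | tauto

end Counting

/-! ### Comparing sums along the path -/

section Sorting

variable {S : Type*} [PositivelyOrderedMonoid S] {p : S} {x : ℝ → S}

theorem IsCuPath.wayBelow_of_lt_max (hp : IsCuCompact p) (hx : IsCuPath p x) {a b : ℝ}
    (h : b < max a 0) : WayBelow (x a) (x b) := by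
  rcases lt_max_iff.1 h with h | h
  · exact hx.wayBelow _ _ h
  · by_cases ha : a < 0
    · rw [hx.eq_of_neg a ha, hx.eq_of_neg b h]
      exact hp
    · exact hx.wayBelow _ _ (h.trans_le (not_lt.1 ha))

/-- Greedy matching: testing the hypothesis at the least point m of A, moved to 0 if negative,
yields a point of B strictly below it. Remove the pair, induct, and add with (O3). -/
theorem IsCuPath.sum_wayBelow_sum [CuSemigroup S] (hp : IsCuCompact p) (hx : IsCuPath p x)
    (A B : Multiset ℝ)
    (h : ∀ t : unitInterval, countLE A t ≤ countLT B t) :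
    WayBelow (A.map x).sum (B.map x).sum := by
  induction hN : A.card generalizing A B with
  | zero =>
    rw [Multiset.card_eq_zero.1 hN]
    simpa using zero_wayBelow _
  | succ N ih =>
    have hne : A.toFinset.Nonempty := by
      rw [Multiset.toFinset_nonempty]
      rintro rfl
      simp at hN
    obtain ⟨m, hm, hmin⟩ := A.toFinset.exists_min_image id hne
    simp only [Multiset.mem_toFinset, id] at hm hmin
    -- Points beyond 1 escape the test on [0,1], but the path vanishes there.
    by_cases h1 : 1 < m
    · have : (A.map x).sum = 0 := by
        refine Multiset.sum_eq_zero fun y hy => ?_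
        obtain ⟨a, ha, rfl⟩ := Multiset.mem_map.1 hy
        exact hx.eq_zero a (h1.le.trans (hmin a ha))
      rw [this]
      exact zero_wayBelow _
    push Not at h1
    have hT := h ⟨max m 0, le_max_right _ _, max_le h1 zero_le_one⟩
    have hpos : 0 < countLT B (max m 0) :=
      lt_of_lt_of_le (Multiset.countP_pos.2 ⟨m, hm, le_max_left _ _⟩) hT
    obtain ⟨b, hb, hbm⟩ := Multiset.countP_pos.1 hpos
    obtain ⟨A', rfl⟩ := Multiset.exists_cons_of_mem hm
    obtain ⟨B', rfl⟩ := Multiset.exists_cons_of_mem hb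
    simp only [Multiset.map_cons, Multiset.sum_cons]
    refine CuSemigroup.axiomO3 _ _ _ _ (hx.wayBelow_of_lt_max hp hbm) (ih A' B' ?_ (by
      simpa using hN))
    intro t
    have ht := h t
    rw [countLE_cons, countLT_cons] at ht
    by_cases hmt : m ≤ t
    · rw [if_pos hmt, if_pos (hbm.trans_le (max_le hmt t.2.1))] at ht
      omega
    · have : countLE A' t = 0 := by
        refine Multiset.countP_eq_zero.2 fun a ha hat => hmt ?_
        exact (hmin a (Multiset.mem_cons_of_mem ha)).trans hat
      omega

end Sorting

/-! ### Approximate differences and their comparison -/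

section StepDatum

variable {S : Type*} [PositivelyOrderedMonoid S] {p : S} {x : ℝ → S}

/-- An element `val` of `S` approximating an integer-valued step function: up to the path `x`, it
lies between the differences `lowP - lowQ` and `upP - upQ` of monotone step functions, which jump
at the points of the given multisets. -/
structure StepDatum (x : ℝ → S) where
  /-- The jumps up of the upper bound. -/
  upP : Multiset ℝ
  /-- The jumps down of the upper bound. -/
  upQ : Multiset ℝ
  /-- The jumps up of the lower bound. -/
  lowP : Multiset ℝ
  /-- The jumps down of the lower bound. -/
  lowQ : Multiset ℝ
  /-- The approximating element. -/
  val : S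
  val_add_le : val + (upQ.map x).sum ≤ (upP.map x).sum
  le_val_add : (lowP.map x).sum ≤ val + (lowQ.map x).sum
  low_le_up : ∀ t : unitInterval,
    countLT lowP t + countLT upQ t ≤ countLE upP t + countLE lowQ t
  low_nonneg : ∀ t : unitInterval, countLE lowQ t ≤ countLT lowP t

namespace StepDatum

instance : Zero (StepDatum x) where
  zero := ⟨0, 0, 0, 0, 0, by simp, by simp, by simp, by simp⟩

instance : Add (StepDatum x) where
  add b d :=
    { upP := b.upP + d.upP
      upQ := b.upQ + d.upQ
      lowP := b.lowP + d.lowP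
      lowQ := b.lowQ + d.lowQ
      val := b.val + d.val
      val_add_le := by
        simpa [add_add_add_comm] using add_le_add b.val_add_le d.val_add_le
      le_val_add := by
        simpa [add_add_add_comm] using add_le_add b.le_val_add d.le_val_add
      low_le_up := fun t => by
        have h1 := b.low_le_up t
        have h2 := d.low_le_up t
        simp only [countLE_add, countLT_add]
        omega
      low_nonneg := fun t => by
        have h1 := b.low_nonneg t
        have h2 := d.low_nonneg t
        simp only [countLE_add, countLT_add]
        omega }

/-- The datum attached to a single half-line `(a, ∞)`. -/
def single (x : ℝ → S) (a : ℝ) : StepDatum x where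
  upP := {a}
  upQ := 0
  lowP := {a}
  lowQ := 0
  val := x a
  val_add_le := by simp
  le_val_add := by simp
  low_le_up t := by
    simp only [countLT_singleton, countLE_singleton, countLE_zero, countLT_zero]
    split_ifs with h1 h2 <;> first | omega | exact absurd h1.le h2
  low_nonneg t := by simp

/-- At `t`, the upper bound of `b` is at most the lower bound of `d`. -/
def PrecAt (b d : StepDatum x) (t : ℝ) : Prop :=
  countLE b.upP t + countLE d.lowQ t ≤ countLT b.upQ t + countLT d.lowP t

/-- On the unit interval, the upper bound of `b` is at most the lower bound of `d`. -/
def Prec (b d : StepDatum x) : Prop :=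
  ∀ t : unitInterval, b.PrecAt d t

theorem PrecAt.trans_prec {b d e : StepDatum x} {t : unitInterval} (h : b.PrecAt d t)
    (h' : d.Prec e) : b.PrecAt e t := by
  have h1 := h' t
  have h2 := d.low_le_up t
  simp only [PrecAt] at *
  omega

theorem Prec.trans {b d e : StepDatum x} (h : b.Prec d) (h' : d.Prec e) : b.Prec e :=
  fun t => (h t).trans_prec h'

theorem Prec.add {b d b' d' : StepDatum x} (h : b.Prec d) (h' : b'.Prec d') :
    (b + b').Prec (d + d') := by
  intro t
  have h1 := h t
  have h2 := h' t
  change countLE (b.upP + b'.upP) t + countLE (d.lowQ + d'.lowQ) t ≤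
    countLT (b.upQ + b'.upQ) t + countLT (d.lowP + d'.lowP) t
  simp only [countLE_add, countLT_add, PrecAt] at *
  omega

/-- Add the jumps down of both bounds: the left side is then at most `upP + lowQ`, the right at
least `upQ + lowP`, and the sorting lemma puts ≪ between these. Weak cancellation removes the added
terms. -/
theorem Prec.wayBelow [CuSemigroup S] (hwc : WeaklyCancellative S) (hp : IsCuCompact p) (hx : IsCuPath p x)
    {b d : StepDatum x} (h : b.Prec d) : WayBelow b.val d.val := by
  refine hwc _ _ ((b.upQ.map x).sum + (d.lowQ.map x).sum) ?_
  have h1 : WayBelow ((b.upP.map x).sum + (d.lowQ.map x).sum)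
      ((b.upQ.map x).sum + (d.lowP.map x).sum) := by
    simpa using hx.sum_wayBelow_sum hp (b.upP + d.lowQ) (b.upQ + d.lowP) fun t => by
      simpa [PrecAt] using h t
  refine LE.le.trans_wayBelow ?_ (h1.trans_le ?_)
  · rw [← add_assoc]
    exact add_le_add b.val_add_le le_rfl
  · rw [add_left_comm]
    exact add_le_add le_rfl d.le_val_add

/-- Upper bounds are upper semicontinuous and lower bounds lower semicontinuous; this is why the
counts mix ≤ and <. -/
theorem PrecAt.eventually {b d : StepDatum x} {t : ℝ} (h : b.PrecAt d t) :
    ∀ᶠ r in nhds t, b.PrecAt d r := by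
  filter_upwards [eventually_countLE_le b.upP t, eventually_countLE_le d.lowQ t,
    eventually_le_countLT b.upQ t, eventually_le_countLT d.lowP t] with r h1 h2 h3 h4
  simp only [PrecAt] at *
  omega

/-- A Dini argument: the sets where the comparison with d i holds form a directed open cover of the
compact interval. -/
theorem exists_prec_of_directed {ι : Type*} [Nonempty ι] (b : StepDatum x) (d : ι → StepDatum x)
    (hd : ∀ i j, ∃ k, (d i).Prec (d k) ∧ (d j).Prec (d k))
    (h : ∀ t : unitInterval, ∃ i, b.PrecAt (d i) t) : ∃ i, b.Prec (d i) := by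
  obtain ⟨i, hi⟩ := isCompact_univ.elim_directed_cover
    (fun i => {t : unitInterval | b.PrecAt (d i) t})
    (fun i => isOpen_iff_mem_nhds.2 fun t ht =>
      continuous_subtype_val.continuousAt.eventually (PrecAt.eventually ht))
    (fun t _ => by simpa using h t)
    (fun i j => by
      obtain ⟨k, h1, h2⟩ := hd i j
      exact ⟨k, fun t ht => PrecAt.trans_prec ht h1, fun t ht => PrecAt.trans_prec ht h2⟩)
  exact ⟨i, fun t => hi (Set.mem_univ t)⟩

end StepDatum

end StepDatum

/-! ### Regularizing a function by local infima -/

section Regularization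

/-- The infimum of `f` over the points at distance at most `r` from `t`, truncated at `m`. -/
noncomputable def lowerReg (f : unitInterval → ℕ∞) (r : ℝ) (m : ℕ) (t : ℝ) : ℕ :=
  (min (m : ℕ∞) (⨅ s : unitInterval, ⨅ _ : |(s : ℝ) - t| ≤ r, f s)).toNat

theorem le_lowerReg_iff {f : unitInterval → ℕ∞} {r : ℝ} {m k : ℕ} {t : ℝ} :
    k ≤ lowerReg f r m t ↔
      k ≤ m ∧ ∀ s : unitInterval, |(s : ℝ) - t| ≤ r → (k : ℕ∞) ≤ f s := by
  have hne : min (m : ℕ∞) (⨅ s : unitInterval, ⨅ _ : |(s : ℝ) - t| ≤ r, f s) ≠ ⊤ :=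
    ne_top_of_le_ne_top (ENat.natCast_ne_top m) (min_le_left _ _)
  rw [lowerReg, ← Nat.cast_le (α := ℕ∞), ENat.natCast_toNat hne, le_min_iff, Nat.cast_le]
  simp only [le_iInf_iff]

theorem lowerReg_mono {f : unitInterval → ℕ∞} {r r' : ℝ} {m m' : ℕ} {t t' : ℝ} (hm : m ≤ m')
    (h : |t - t'| + r' ≤ r) : lowerReg f r m t ≤ lowerReg f r' m' t' := by
  obtain ⟨h1, h2⟩ := le_lowerReg_iff.1 (le_refl (lowerReg f r m t))
  refine le_lowerReg_iff.2 ⟨h1.trans hm, fun s hs => h2 s ?_⟩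
  have := abs_sub_le (s : ℝ) t' t
  rw [abs_sub_comm t' t] at this
  linarith

end Regularization

/-! ### Jordan decomposition of a sampled function -/

section Jumps

/-- The jumps up of a sequence of natural numbers. -/
def jumpUp (v : ℕ → ℕ) : ℕ → ℕ
  | 0 => v 0
  | i + 1 => v (i + 1) - v i

/-- The jumps down of a sequence of natural numbers. -/
def jumpDown (v : ℕ → ℕ) : ℕ → ℕ
  | 0 => 0
  | i + 1 => v i - v (i + 1)

theorem sum_jumpUp (v : ℕ → ℕ) (i : ℕ) :
    ∑ j ∈ Finset.range (i + 1), jumpUp v j =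
      v i + ∑ j ∈ Finset.range (i + 1), jumpDown v j := by
  induction i with
  | zero => simp [jumpUp, jumpDown]
  | succ i ih =>
    rw [Finset.sum_range_succ, ih, Finset.sum_range_succ _ (i + 1)]
    simp only [jumpUp, jumpDown]
    omega

/-- The multiset containing `w i` copies of `g i` for `i < M`. -/
def jumpPoints (w : ℕ → ℕ) (g : ℕ → ℝ) (M : ℕ) : Multiset ℝ :=
  ∑ i ∈ Finset.range M, Multiset.replicate (w i) (g i)

theorem countP_jumpPoints (q : ℝ → Prop) [DecidablePred q] (w : ℕ → ℕ) (g : ℕ → ℝ) (M : ℕ) :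
    (jumpPoints w g M).countP q = ∑ i ∈ Finset.range M, if q (g i) then w i else 0 := by
  have : (jumpPoints w g M).countP q = Multiset.countPAddMonoidHom q (jumpPoints w g M) := rfl
  rw [this, jumpPoints, map_sum]
  refine Finset.sum_congr rfl fun i _ => ?_
  rw [Multiset.coe_countPAddMonoidHom, ← Multiset.coe_replicate, Multiset.coe_countP,
    List.countP_replicate]
  simp

theorem countP_jumpPoints_le (q : ℝ → Prop) [DecidablePred q] (w : ℕ → ℕ) (g : ℕ → ℝ) (M k : ℕ)
    (h : ∀ j, q (g j) → j < k) :
    (jumpPoints w g M).countP q ≤ ∑ j ∈ Finset.range k, w j := by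
  rw [countP_jumpPoints, ← Finset.sum_filter]
  refine Finset.sum_le_sum_of_subset fun j hj => ?_
  simpa using h j (Finset.mem_filter.1 hj).2

theorem le_countP_jumpPoints (q : ℝ → Prop) [DecidablePred q] (w : ℕ → ℕ) (g : ℕ → ℝ) (M k : ℕ)
    (hk : k ≤ M) (h : ∀ j < k, q (g j)) :
    ∑ j ∈ Finset.range k, w j ≤ (jumpPoints w g M).countP q := by
  rw [countP_jumpPoints, ← Finset.sum_filter]
  refine Finset.sum_le_sum_of_subset fun j hj => ?_
  rw [Finset.mem_range] at hj
  simpa using ⟨hj.trans_le hk, h j hj⟩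

end Jumps

/-! ### Step data from a grid -/

section Grid

variable {S : Type*} [PositivelyOrderedMonoid S] [CuSemigroup S] {p : S} {x : ℝ → S}

/-- (O5) with y = 0, applied to Q ≪ Q' ≤ P (as sums along x), gives c with Q + c ≤ P ≤ Q' + c. -/
theorem exists_stepDatum_of_multisets (hO5 : SatisfiesO5 S) (hp : IsCuCompact p)
    (hx : IsCuPath p x) (P Q' Q : Multiset ℝ)
    (h1 : ∀ t : unitInterval, countLE Q' t ≤ countLT P t)
    (h2 : ∀ t : unitInterval, countLE Q t ≤ countLT Q' t) :
    ∃ b : StepDatum x, b.upP = P ∧ b.upQ = Q ∧ b.lowP = P ∧ b.lowQ = Q' := by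
  obtain ⟨c, hc1, hc2, _⟩ := hO5 (Q.map x).sum (Q'.map x).sum 0 0 (P.map x).sum
    (by simpa using (hx.sum_wayBelow_sum hp Q' P h1).le) (hx.sum_wayBelow_sum hp Q Q' h2)
    (zero_wayBelow 0)
  have hlt : ∀ (A : Multiset ℝ) (t : ℝ), countLT A t ≤ countLE A t := fun A t => by
    simp only [countLT, countLE, Multiset.countP_eq_card_filter]
    exact Multiset.card_le_card (Multiset.monotone_filter_right A fun _ h => le_of_lt h)
  refine ⟨⟨P, Q, P, Q', c, by rwa [add_comm], by rwa [add_comm], fun t => ?_, h1⟩,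
    rfl, rfl, rfl, rfl⟩
  have := hlt P t
  have := hlt Q t
  have := hlt Q' t
  have := h2 t
  omega

/-- Sample the regularization of radius 4δ on a grid of mesh δ. The samples that matter at t lie
within 2δ of t, so they are squeezed between the regularizations at t of radii 6δ and 2δ. -/
theorem exists_stepDatum_grid (hO5 : SatisfiesO5 S) (hp : IsCuCompact p) (hx : IsCuPath p x)
    (f : unitInterval → ℕ∞) {δ : ℝ} (hδ : 0 < δ) (m : ℕ) :
    ∃ b : StepDatum x, ∀ t : unitInterval,
      countLE b.upP t ≤ countLT b.upQ t + lowerReg f (2 * δ) m t ∧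
      lowerReg f (6 * δ) m t + countLE b.lowQ t ≤ countLT b.lowP t := by
  -- The grid starts at -δ, so that the initial jump lies strictly left of [0,1].
  set g : ℕ → ℝ := fun i => ((i : ℝ) - 1) * δ with hg
  set v : ℕ → ℕ := fun i => lowerReg f (4 * δ) m (g i) with hv
  set M : ℕ := ⌊1 / δ⌋₊ + 1 with hM
  set P := jumpPoints (jumpUp v) g M with hP
  set Q' := jumpPoints (jumpDown v) g M with hQ'
  -- Delaying the jumps down by half a mesh gives the ≪ needed for (O5).
  set Q := jumpPoints (jumpDown v) (fun i => g i + δ / 2) M with hQ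
  have hgmono : StrictMono g := fun i j hij => by
    have : (i : ℝ) < j := by exact_mod_cast hij
    simp only [hg]
    nlinarith
  have hgsucc : ∀ i, g (i + 1) = g i + δ := fun i => by
    simp only [hg]
    push_cast
    ring
  have hcell : ∀ t : unitInterval, ∃ i, i + 1 ≤ M ∧ g (i + 1) ≤ t ∧ (t : ℝ) < g (i + 2) := by
    intro t
    refine ⟨⌊(t : ℝ) / δ⌋₊, ?_, ?_, ?_⟩
    · have : ⌊(t : ℝ) / δ⌋₊ ≤ ⌊1 / δ⌋₊ := Nat.floor_le_floor (by gcongr; exact t.2.2)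
      omega
    · have := Nat.floor_le (div_nonneg t.2.1 hδ.le)
      rw [le_div_iff₀ hδ] at this
      simpa [hg] using this
    · have := Nat.lt_floor_add_one ((t : ℝ) / δ)
      rw [div_lt_iff₀ hδ] at this
      simp only [hg]
      push_cast
      linarith
  have hup : ∀ t : unitInterval, countLE P t ≤ countLT Q t + lowerReg f (2 * δ) m t := by
    intro t
    obtain ⟨i, hi, h1, h2⟩ := hcell t
    have hs := hgsucc i
    have hs' := hgsucc (i + 1)
    have e1 : countLE P t ≤ ∑ j ∈ Finset.range (i + 1 + 1), jumpUp v j :=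
      countP_jumpPoints_le _ _ _ _ _ fun j hj => by
        exact hgmono.lt_iff_lt.1 (lt_of_le_of_lt hj h2)
    have e2 : ∑ j ∈ Finset.range (i + 1), jumpDown v j ≤ countLT Q t :=
      le_countP_jumpPoints _ _ _ _ _ hi fun j hj => by
        have := hgmono.monotone (Nat.lt_succ_iff.1 hj)
        linarith
    -- The upper bound at t is at most v (i + 1) plus the last jump down, which is max (v i) (v (i +
    -- 1)).
    rw [sum_jumpUp, Finset.sum_range_succ] at e1
    have e3 : v i ≤ lowerReg f (2 * δ) m t :=
      lowerReg_mono le_rfl (by rw [abs_sub_comm, abs_of_nonneg] <;> linarith)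
    have e4 : v (i + 1) ≤ lowerReg f (2 * δ) m t :=
      lowerReg_mono le_rfl (by rw [abs_sub_comm, abs_of_nonneg] <;> linarith)
    rw [show jumpDown v (i + 1) = v i - v (i + 1) from rfl] at e1
    omega
  have hlow : ∀ t : unitInterval, lowerReg f (6 * δ) m t + countLE Q' t ≤ countLT P t := by
    intro t
    obtain ⟨i, hi, h1, h2⟩ := hcell t
    have hs := hgsucc i
    have hs' := hgsucc (i + 1)
    have e1 : countLE Q' t ≤ ∑ j ∈ Finset.range (i + 1 + 1), jumpDown v j :=
      countP_jumpPoints_le _ _ _ _ _ fun j hj => by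
        exact hgmono.lt_iff_lt.1 (lt_of_le_of_lt hj h2)
    have e2 : ∑ j ∈ Finset.range (i + 1), jumpUp v j ≤ countLT P t :=
      le_countP_jumpPoints _ _ _ _ _ hi fun j hj =>
        lt_of_lt_of_le (hgmono hj) h1
    -- The lower bound at t is at least v i minus the last jump down, which is min (v i) (v (i +
    -- 1)).
    rw [sum_jumpUp] at e2
    rw [Finset.sum_range_succ] at e1
    have e3 : lowerReg f (6 * δ) m t ≤ v i :=
      lowerReg_mono le_rfl (by rw [abs_of_nonneg] <;> linarith)
    have e4 : lowerReg f (6 * δ) m t ≤ v (i + 1) :=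
      lowerReg_mono le_rfl (by rw [abs_of_nonneg] <;> linarith)
    rw [show jumpDown v (i + 1) = v i - v (i + 1) from rfl] at e1
    omega
  obtain ⟨b, h1, h2, h3, h4⟩ := exists_stepDatum_of_multisets hO5 hp hx P Q' Q
    (fun t => by have := hlow t; omega)
    (fun t => by
      simp only [countLE, countLT, hQ, hQ', countP_jumpPoints]
      refine Finset.sum_le_sum fun j _ => ?_
      split_ifs with h1 h2 <;> first | omega | (exfalso; linarith))
  exact ⟨b, fun t => by rw [h1, h2, h3, h4]; exact ⟨hup t, hlow t⟩⟩

end Grid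

/-! ### Exhausting lower semicontinuous functions by step data -/

section Representation

variable {S : Type*} [PositivelyOrderedMonoid S] {p : S} {x : ℝ → S}

/-- The sequence `b` of step data increases to the function `f`. -/
structure Represents (b : ℕ → StepDatum x) (f : Lsc unitInterval) : Prop where
  prec_succ : ∀ n, (b n).Prec (b (n + 1))
  up_le : ∀ n (t : unitInterval) (k : ℕ),
    k + countLT (b n).upQ t ≤ countLE (b n).upP t → (k : ℕ∞) ≤ f.1 t
  exists_le_low : ∀ (t : unitInterval) (k : ℕ), (k : ℕ∞) ≤ f.1 t →
    ∃ n, k + countLE (b n).lowQ t ≤ countLT (b n).lowP t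

/-- With δ = 3^{-m}, the upper radius 2δ at stage m equals the lower radius 6δ at stage m + 1, so
consecutive data are comparable. -/
theorem exists_represents [CuSemigroup S] (hO5 : SatisfiesO5 S) (hp : IsCuCompact p) (hx : IsCuPath p x)
    (f : Lsc unitInterval) : ∃ b : ℕ → StepDatum x, Represents b f := by
  choose b hb using fun m : ℕ =>
    exists_stepDatum_grid hO5 hp hx f.1 (δ := (1 / 3) ^ m) (by positivity) m
  refine ⟨b, fun m t => ?_, fun m t k hk => ?_, fun t k hk => ?_⟩
  · have h1 := (hb m t).1
    have h2 := (hb (m + 1) t).2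
    have h3 : lowerReg f.1 (2 * (1 / 3) ^ m) m t ≤
        lowerReg f.1 (6 * (1 / 3) ^ (m + 1)) (m + 1) t :=
      lowerReg_mono (Nat.le_succ m) (by rw [pow_succ]; simp; linarith)
    simp only [StepDatum.PrecAt]
    omega
  · have h1 := (hb m t).1
    have h2 : k ≤ lowerReg f.1 (2 * (1 / 3) ^ m) m t := by omega
    exact (le_lowerReg_iff.1 h2).2 t (by simp)
  · have hopen : ∀ᶠ s in nhds t, (k : ℕ∞) ≤ f.1 s := by
      cases k with
      | zero => simp
      | succ k =>
        have hlt : (k : ℕ∞) < f.1 t :=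
          lt_of_lt_of_le (by exact_mod_cast Nat.lt_succ_self k) hk
        filter_upwards [f.2 t k hlt] with s hs
        push_cast
        exact Order.add_one_le_of_lt hs
    obtain ⟨ε, hε, hball⟩ := Metric.eventually_nhds_iff.1 hopen
    obtain ⟨m, hm⟩ := exists_pow_lt_of_lt_one (show 0 < ε / 6 by positivity)
      (show (1 / 3 : ℝ) < 1 by norm_num)
    refine ⟨max m k, ?_⟩
    have h1 := (hb (max m k) t).2
    have h2 : k ≤ lowerReg f.1 (6 * (1 / 3) ^ (max m k)) (max m k) t := by
      refine le_lowerReg_iff.2 ⟨le_max_right _ _, fun s hs => hball ?_⟩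
      have h3 : (1 / 3 : ℝ) ^ (max m k) ≤ (1 / 3) ^ m :=
        pow_le_pow_of_le_one (by norm_num) (by norm_num) (le_max_left _ _)
      rw [Subtype.dist_eq, Real.dist_eq]
      linarith
    omega

namespace Represents

variable {b d : ℕ → StepDatum x} {f g : Lsc unitInterval}

theorem prec_of_lt (h : Represents b f) {i j : ℕ} (hij : i < j) : (b i).Prec (b j) := by
  induction j, hij using Nat.le_induction with
  | base => exact h.prec_succ i
  | succ j _ ih => exact ih.trans (h.prec_succ j)

theorem low_le_low (h : Represents b f) {i j : ℕ} (hij : i ≤ j) (t : unitInterval) {k : ℕ}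
    (hk : k + countLE (b i).lowQ t ≤ countLT (b i).lowP t) :
    k + countLE (b j).lowQ t ≤ countLT (b j).lowP t := by
  rcases hij.eq_or_lt with rfl | hij
  · exact hk
  · have h1 := h.prec_of_lt hij t
    have h2 := (b i).low_le_up t
    simp only [StepDatum.PrecAt] at h1
    omega

theorem low_le (h : Represents b f) (n : ℕ) (t : unitInterval) {k : ℕ}
    (hk : k + countLE (b n).lowQ t ≤ countLT (b n).lowP t) : (k : ℕ∞) ≤ f.1 t :=
  h.up_le n t k (by have := (b n).low_le_up t; omega)

theorem exists_precAt (h : Represents b f) (e : StepDatum x) (t : unitInterval)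
    (he : ∀ k : ℕ, k + countLT e.upQ t ≤ countLE e.upP t → (k : ℕ∞) ≤ f.1 t) :
    ∃ n, e.PrecAt (b n) t := by
  by_cases hc : countLT e.upQ t ≤ countLE e.upP t
  · obtain ⟨n, hn⟩ := h.exists_le_low t (countLE e.upP t - countLT e.upQ t)
      (he _ (by omega))
    exact ⟨n, by simp only [StepDatum.PrecAt]; omega⟩
  · have := (b 0).low_nonneg t
    exact ⟨0, by simp only [StepDatum.PrecAt]; omega⟩

theorem exists_prec (h : Represents b f) (h' : Represents d g) (hfg : f ≤ g) (n : ℕ) :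
    ∃ m, (b n).Prec (d m) := by
  refine StepDatum.exists_prec_of_directed (b n) d (fun i j => ?_) fun t =>
    h'.exists_precAt (b n) t fun k hk => (h.up_le n t k hk).trans (hfg t)
  exact ⟨max i j + 1, h'.prec_of_lt (by omega), h'.prec_of_lt (by omega)⟩

theorem add (h : Represents b f) (h' : Represents d g) :
    Represents (fun n => b n + d n) (f + g) where
  prec_succ n := (h.prec_succ n).add (h'.prec_succ n)
  up_le n t k hk := by
    change k + countLT ((b n).upQ + (d n).upQ) t ≤ countLE ((b n).upP + (d n).upP) t at hk
    rw [countLT_add, countLE_add] at hk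
    change (k : ℕ∞) ≤ f.1 t + g.1 t
    have hb : ∀ k : ℕ, k ≤ countLE (b n).upP t - countLT (b n).upQ t → (k : ℕ∞) ≤ f.1 t := by
      intro k hk
      by_cases h0 : k = 0
      · simp [h0]
      · exact h.up_le n t k (by omega)
    have hd : ∀ k : ℕ, k ≤ countLE (d n).upP t - countLT (d n).upQ t → (k : ℕ∞) ≤ g.1 t := by
      intro k hk
      by_cases h0 : k = 0
      · simp [h0]
      · exact h'.up_le n t k (by omega)
    refine le_trans ?_ (add_le_add (hb _ le_rfl) (hd _ le_rfl))
    exact_mod_cast (show k ≤ _ by omega)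
  exists_le_low t k hk := by
    change (k : ℕ∞) ≤ f.1 t + g.1 t at hk
    obtain ⟨k₁, k₂, rfl, h1, h2⟩ :
        ∃ k₁ k₂ : ℕ, k = k₁ + k₂ ∧ (k₁ : ℕ∞) ≤ f.1 t ∧ (k₂ : ℕ∞) ≤ g.1 t := by
      -- If f t < k then f t is finite and can be cancelled, leaving k - f t ≤ g t.
      by_cases hf : (k : ℕ∞) ≤ f.1 t
      · exact ⟨k, 0, rfl, hf, by simp⟩
      · have hlt := not_le.1 hf
        obtain ⟨a, ha⟩ := ENat.ne_top_iff_exists.1 hlt.ne_top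
        rw [← ha] at hk hlt ⊢
        have hak : a < k := by exact_mod_cast hlt
        refine ⟨a, k - a, by omega, le_rfl, ?_⟩
        have hsplit : (k : ℕ∞) = a + (k - a : ℕ) := by
          exact_mod_cast (show k = a + (k - a) by omega)
        rw [hsplit] at hk
        exact (ENat.add_le_add_iff_left (ENat.natCast_ne_top a)).1 hk
    obtain ⟨n₁, hn₁⟩ := h.exists_le_low t k₁ h1
    obtain ⟨n₂, hn₂⟩ := h'.exists_le_low t k₂ h2
    have e1 := h.low_le_low (le_max_left n₁ n₂) t hn₁
    have e2 := h'.low_le_low (le_max_right n₁ n₂) t hn₂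
    refine ⟨max n₁ n₂, ?_⟩
    change k₁ + k₂ + countLE ((b _).lowQ + (d _).lowQ) t ≤ countLT ((b _).lowP + (d _).lowP) t
    rw [countLE_add, countLT_add]
    omega

end Represents

end Representation

namespace Lsc

variable {X : Type*} [TopologicalSpace X]

/-- The pointwise supremum of a sequence. -/
noncomputable def iSupSeq (u : ℕ → Lsc X) : Lsc X :=
  ⟨fun t => ⨆ n, (u n).1 t, lowerSemicontinuous_iSup fun n => (u n).2⟩

theorem isLUB_iSupSeq (u : ℕ → Lsc X) : IsLUB (Set.range u) (iSupSeq u) := by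
  refine ⟨?_, fun b hb t => iSup_le fun n => hb ⟨n, rfl⟩ t⟩
  rintro _ ⟨n, rfl⟩ t
  exact le_iSup (fun n => (u n).1 t) n

theorem exists_natCast_le_of_isLUB {u : ℕ → Lsc X} {a : Lsc X} (h : IsLUB (Set.range u) a)
    {t : X} {k : ℕ} (hk : (k : ℕ∞) ≤ a.1 t) : ∃ n, (k : ℕ∞) ≤ (u n).1 t := by
  rw [h.unique (isLUB_iSupSeq u)] at hk
  cases k with
  | zero => exact ⟨0, by simp⟩
  | succ k =>
    have hlt : (k : ℕ∞) < ⨆ n, (u n).1 t :=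
      lt_of_lt_of_le (by exact_mod_cast Nat.lt_succ_self k) hk
    obtain ⟨n, hn⟩ := lt_iSup_iff.1 hlt
    exact ⟨n, by push_cast; exact Order.add_one_le_of_lt hn⟩

end Lsc

/-! ### Lower bounds as functions, and representations of indicators -/

section LowerFunction

variable {S : Type*} [PositivelyOrderedMonoid S] {x : ℝ → S}

/-- The lower bound of a step datum, as a lower semicontinuous function. -/
noncomputable def StepDatum.lowFun (b : StepDatum x) : Lsc unitInterval :=
  ⟨fun t => ((countLT b.lowP t - countLE b.lowQ t : ℕ) : ℕ∞), fun t k hk => by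
    have h := continuous_subtype_val.continuousAt (x := t)
    filter_upwards [h.eventually (eventually_le_countLT b.lowP t),
      h.eventually (eventually_countLE_le b.lowQ t)] with s h1 h2
    refine lt_of_lt_of_le hk ?_
    exact Nat.cast_le.2 (by omega)⟩

namespace Represents

variable {b : ℕ → StepDatum x} {f : Lsc unitInterval}

theorem lowFun_monotone (h : Represents b f) : Monotone fun n => (b n).lowFun := by
  intro i j hij t
  have h1 := (b i).low_nonneg t
  have h2 := h.low_le_low hij t (k := countLT (b i).lowP t - countLE (b i).lowQ t) (by omega)
  exact Nat.cast_le.2 (by omega)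

theorem isLUB_lowFun (h : Represents b f) : IsLUB (Set.range fun n => (b n).lowFun) f := by
  refine ⟨?_, fun g hg t => ?_⟩
  · rintro _ ⟨n, rfl⟩ t
    have := (b n).low_nonneg t
    exact h.low_le n t (by omega)
  · refine ENat.forall_natCast_le_iff_le.1 fun k hk => ?_
    obtain ⟨n, hn⟩ := h.exists_le_low t k hk
    refine le_trans ?_ (hg ⟨n, rfl⟩ t)
    exact Nat.cast_le.2 (by omega)

theorem prec_of_le_lowFun (h : Represents b f) {d : StepDatum x} (hd : f ≤ d.lowFun) (n : ℕ) :
    (b n).Prec d := by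
  intro t
  have h0 := d.low_nonneg t
  by_cases hc : countLT (b n).upQ t ≤ countLE (b n).upP t
  · have h1 := (h.up_le n t (countLE (b n).upP t - countLT (b n).upQ t) (by omega)).trans (hd t)
    have h2 := Nat.cast_le.1 h1
    simp only [StepDatum.PrecAt]
    omega
  · simp only [StepDatum.PrecAt]
    omega

end Represents

theorem represents_single {f : Lsc unitInterval} {a : ℕ → ℝ}
    (h1 : ∀ n (t : unitInterval), a n ≤ t → a (n + 1) < t)
    (h2 : ∀ n (t : unitInterval), a n ≤ t → 1 ≤ f.1 t)
    (h3 : ∀ t : unitInterval, f.1 t ≤ 1 ∧ (1 ≤ f.1 t → ∃ n, a n < t)) :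
    Represents (fun n => StepDatum.single x (a n)) f where
  prec_succ n t := by
    have := h1 n t
    simp only [StepDatum.PrecAt, StepDatum.single, countLE_singleton, countLT_singleton,
      countLE_zero, countLT_zero]
    split_ifs <;> first | omega | tauto
  up_le n t k hk := by
    simp only [StepDatum.single, countLE_singleton, countLT_zero] at hk
    split_ifs at hk with h
    · exact le_trans (by exact_mod_cast hk) (h2 n t h)
    · obtain rfl : k = 0 := by omega
      simp
  exists_le_low t k hk := by
    have hk1 : k ≤ 1 := by exact_mod_cast hk.trans (h3 t).1
    simp only [StepDatum.single, countLE_zero, countLT_singleton]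
    obtain rfl | rfl : k = 0 ∨ k = 1 := by omega
    · exact ⟨0, by simp⟩
    · obtain ⟨n, hn⟩ := (h3 t).2 (by exact_mod_cast hk)
      exact ⟨n, by simp [hn]⟩

end LowerFunction

/-! ### The morphism induced by a path -/

section Morphism

variable {S : Type*} [PositivelyOrderedMonoid S] [CuSemigroup S] {p : S} {x : ℝ → S}

theorem Represents.val_monotone (hwc : WeaklyCancellative S) (hp : IsCuCompact p)
    (hx : IsCuPath p x) {b : ℕ → StepDatum x} {f : Lsc unitInterval} (h : Represents b f) :
    Monotone fun n => (b n).val :=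
  monotone_nat_of_le_succ fun n => ((h.prec_succ n).wayBelow hwc hp hx).le

theorem Represents.val_le_of_le (hwc : WeaklyCancellative S) (hp : IsCuCompact p)
    (hx : IsCuPath p x) {b d : ℕ → StepDatum x} {f g : Lsc unitInterval} (h : Represents b f)
    (h' : Represents d g) (hfg : f ≤ g) {a c : S} (ha : IsLUB (Set.range fun n => (b n).val) a)
    (hc : IsLUB (Set.range fun n => (d n).val) c) : a ≤ c := by
  refine ha.2 ?_
  rintro _ ⟨n, rfl⟩
  obtain ⟨m, hm⟩ := h.exists_prec h' hfg n
  exact ((hm.wayBelow hwc hp hx).le).trans (hc.1 ⟨m, rfl⟩)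

/-- Every `≪`-decreasing path ending at a compact element is induced by a `Cu`-morphism. -/
theorem exists_cuMorphism_of_isCuPath (hwc : WeaklyCancellative S) (hO5 : SatisfiesO5 S)
    (hp : IsCuCompact p) (hx : IsCuPath p x) :
    ∃ φ : CuMorphism (Lsc unitInterval) S, ∀ (f : Lsc unitInterval) (b : ℕ → StepDatum x),
      Represents b f → IsLUB (Set.range fun n => (b n).val) (φ f) := by
  choose b hb using exists_represents hO5 hp hx
  choose φ hφ using fun f => CuSemigroup.axiomO1 _ ((hb f).val_monotone hwc hp hx)
  have hlub : ∀ f (d : ℕ → StepDatum x), Represents d f →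
      IsLUB (Set.range fun n => (d n).val) (φ f) := by
    intro f d hd
    obtain ⟨c, hc⟩ := CuSemigroup.axiomO1 _ (hd.val_monotone hwc hp hx)
    rwa [le_antisymm ((hb f).val_le_of_le hwc hp hx hd le_rfl (hφ f) hc)
      (hd.val_le_of_le hwc hp hx (hb f) le_rfl hc (hφ f))]
  have hmono : ∀ f g, f ≤ g → φ f ≤ φ g := fun f g hfg =>
    (hb f).val_le_of_le hwc hp hx (hb g) hfg (hφ f) (hφ g)
  have hadd : ∀ f g, φ (f + g) = φ f + φ g := fun f g =>
    (hlub _ _ ((hb f).add (hb g))).unique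
      (CuSemigroup.axiomO4 _ _ _ _ ((hb f).val_monotone hwc hp hx)
        ((hb g).val_monotone hwc hp hx) (hφ f) (hφ g))
  have hzero : φ 0 = 0 := by
    have h0 : Represents (fun _ => (0 : StepDatum x)) (0 : Lsc unitInterval) :=
      { prec_succ := fun _ t => show countLE 0 _ + countLE 0 _ ≤ countLT 0 _ + countLT 0 _ by simp
        up_le := fun _ t k hk => by
          change k + countLT 0 _ ≤ countLE 0 _ at hk
          obtain rfl : k = 0 := by simpa using hk
          simp
        exists_le_low := fun t k hk => by
          change (k : ℕ∞) ≤ 0 at hk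
          refine ⟨0, show k + countLE 0 _ ≤ countLT 0 _ from ?_⟩
          simpa using hk }
    refine (hlub _ _ h0).unique ?_
    change IsLUB (Set.range fun _ : ℕ => (0 : S)) 0
    simp
  refine ⟨⟨⟨⟨φ, hzero⟩, hadd⟩, hmono, ?_, ?_⟩, hlub⟩
  · intro f g hfg
    -- Since g is the supremum of its lower bounds, f lies below one of them; then φ f ≤ val m ≪ val
    -- (m + 1) ≤ φ g.
    obtain ⟨m, hm⟩ := hfg _ _ (hb g).lowFun_monotone (hb g).isLUB_lowFun le_rfl
    have h1 : φ f ≤ (b g m).val := by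
      refine (hφ f).2 ?_
      rintro _ ⟨n, rfl⟩
      exact (((hb f).prec_of_le_lowFun hm n).wayBelow hwc hp hx).le
    exact (h1.trans_wayBelow (((hb g).prec_succ m).wayBelow hwc hp hx)).trans_le
      ((hφ g).1 ⟨m + 1, rfl⟩)
  · intro u a hu ha
    refine ⟨?_, fun c hc => (hφ a).2 ?_⟩
    · rintro _ ⟨n, rfl⟩
      exact hmono _ _ (ha.1 ⟨n, rfl⟩)
    · rintro _ ⟨n, rfl⟩
      -- The data of all the u j together form a directed family, to which the compactness argument
      -- applies at once.
      obtain ⟨⟨j, m⟩, hjm⟩ := StepDatum.exists_prec_of_directed (b a n)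
        (fun q : ℕ × ℕ => b (u q.1) q.2)
        (fun q r => by
          obtain ⟨m₁, h₁⟩ := (hb (u q.1)).exists_prec (hb (u (max q.1 r.1)))
            (hu (le_max_left _ _)) q.2
          obtain ⟨m₂, h₂⟩ := (hb (u r.1)).exists_prec (hb (u (max q.1 r.1)))
            (hu (le_max_right _ _)) r.2
          exact ⟨(max q.1 r.1, max m₁ m₂ + 1),
            h₁.trans ((hb _).prec_of_lt (by omega)), h₂.trans ((hb _).prec_of_lt (by omega))⟩)
        (fun t => by
          obtain ⟨j, hj⟩ := Lsc.exists_natCast_le_of_isLUB ha (t := t)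
            (k := countLE (b a n).upP t - countLT (b a n).upQ t) (by
              by_cases hc : countLT (b a n).upQ t ≤ countLE (b a n).upP t
              · exact (hb a).up_le n t _ (by omega)
              · rw [Nat.sub_eq_zero_of_le (by omega)]
                simp)
          obtain ⟨m, hm⟩ := (hb (u j)).exists_precAt (b a n) t fun k hk =>
            (Nat.cast_le.2 (by omega)).trans hj
          exact ⟨(j, m), hm⟩)
      exact ((hjm.wayBelow hwc hp hx).le.trans ((hφ (u j)).1 ⟨m, rfl⟩)).trans (hc ⟨j, rfl⟩)

end Morphism

theorem mainTheorem6 {S : Type*} [PositivelyOrderedMonoid S] [CuSemigroup S]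
    (hwc : WeaklyCancellative S) (hO5 : SatisfiesO5 S)
    (n : ℕ) (hn : 1 ≤ n) (s : ℕ → S)
    (hs : ∀ k : ℕ, 1 ≤ k → k < n → WayBelow (s k) (s (k + 1)))
    (p : S) (hp : IsCuCompact p) (hsp : s n ≤ p) :
    ∃ φ : CuMorphism (Lsc unitInterval) S,
      (∀ k : ℕ, 1 ≤ k → k ≤ n →
        φ (Lsc.chi (openUpper (((n : ℝ) - (k : ℝ)) / (n : ℝ)))) = s k) ∧
      φ 1 = p := by
  obtain ⟨x, hx, hxs⟩ := exists_isCuPath hn hs hp hsp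
  obtain ⟨φ, hφ⟩ := exists_cuMorphism_of_isCuPath hwc hO5 hp hx
  refine ⟨φ, fun k hk1 hkn => ?_, ?_⟩
  · set r : ℝ := ((n : ℝ) - k) / n
    have hchi : ∀ t : unitInterval, (Lsc.chi (openUpper r)).1 t = if r < t then 1 else 0 :=
      fun t => by simp [Lsc.chi, openUpper, Set.indicator_apply]
    refine (hφ _ _ (represents_single (a := fun m : ℕ => r + 1 / ((m : ℝ) + 1))
      (fun m t ht => ?_) (fun m t ht => ?_) fun t => ?_)).unique (hxs k hk1 hkn)
    · refine lt_of_lt_of_le ?_ ht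
      have := Nat.one_div_lt_one_div (α := ℝ) (Nat.lt_succ_self m)
      simpa using this
    · have : 0 < 1 / ((m : ℝ) + 1) := by positivity
      rw [hchi, if_pos (by linarith)]
    · rw [hchi]
      split_ifs with h
      · obtain ⟨m, hm⟩ := exists_nat_one_div_lt (sub_pos.2 h)
        exact ⟨le_rfl, fun _ => ⟨m, by linarith⟩⟩
      · simp
  · have hone : ∀ t : unitInterval, (1 : Lsc unitInterval).1 t = 1 := fun _ => rfl
    have hneg : ∀ t : unitInterval, (-1 : ℝ) < t := fun t => by linarith [t.2.1]
    -- The constant sequence -1 is admissible, as strictness is only tested on [0,1], and x (-1) =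
    -- p.
    refine (hφ _ _ (represents_single (a := fun _ => -1) (fun _ t _ => hneg t)
      (fun _ t _ => (hone t).ge) fun t => ⟨(hone t).le, fun _ => ⟨0, hneg t⟩⟩)).unique ?_
    simp [StepDatum.single, hx.eq_of_neg (-1) (by norm_num)]
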